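/- Let $d \ge 2$ and let $S^d$ be the unit sphere of $E^{d+1}$ with the spherical distance $|ab|$ (the angle between $a$ and $b$). A set $C \subset S^d$ is convex if it contains no pair of antipodes and contains, with any two of its points, the shorter great-circle arc connecting them; a convex body is a closed convex set with non-empty interior in $S^d$. A hemisphere $K$ (a closed ball of radius $\pi/2$) supports a convex body $C$ if $C \subset K$ and ${\rm bd}(C) \cap {\rm bd}(K) \neq \emptyset$. If hemispheres $G$ and $H$ are different and not opposite, $G \cap H$ is a lune, and its thickness is the spherical distance between the centers of the two $(d-1)$-dimensional hemispheres ${\rm bd}(G)\cap H$ and ${\rm bd}(H)\cap G$ bounding it. For a hemisphere $K$ supporting $C$, the width ${\rm width}_K(C)$ is the smallest thickness of a lune $K \cap K'$ over all hemispheres $K'$ supporting $C$ that form a lune with $K$. The body $C$ is of constant width $w$ if ${\rm width}_K(C) = w$ for every hemisphere $K$ supporting $C$. Theorem. If $W \subset S^d$ is a body of constant width $w$, then ${\rm diam}(W) = w$, where ${\rm diam}(W) = \max_{a,b \in W} |ab|$ is the diameter with respect to the spherical distance. -/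

import Mathlib

noncomputable section

namespace SphericalConvex

/-- The unit sphere `S^d` of the Euclidean space `E^(d+1)`, with the subspace topology. -/
abbrev Sph (d : ℕ) : Type := Metric.sphere (0 : EuclideanSpace ℝ (Fin (d + 1))) 1

variable {d : ℕ}

/-- The spherical distance `|ab|`: the length of the arc joining `a` and `b`, that is, the angle
between the unit vectors `a` and `b` (it is `0` for coinciding points, `π` for antipodes). -/
def sdist (a b : Sph d) : ℝ :=
  InnerProductGeometry.angle (a : EuclideanSpace ℝ (Fin (d + 1))) b

/-- The arc `ab`, for `a`, `b` which are not antipodes: the shorter part of the great circle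
through `a` and `b`, consisting of the points of the sphere in the cone spanned by `a`, `b`. -/
def arc (a b : Sph d) : Set (Sph d) :=
  {x | ∃ s t : ℝ, 0 ≤ s ∧ 0 ≤ t ∧
    (x : EuclideanSpace ℝ (Fin (d + 1))) =
      s • (a : EuclideanSpace ℝ (Fin (d + 1))) + t • (b : EuclideanSpace ℝ (Fin (d + 1)))}

/-- A set on the sphere is convex if it contains no pair of antipodes and contains, with any two
of its points, the arc connecting them. -/
def IsConvex (C : Set (Sph d)) : Prop :=
  (∀ x ∈ C, -x ∉ C) ∧ ∀ a ∈ C, ∀ b ∈ C, arc a b ⊆ C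

/-- A convex body: a closed convex set with non-empty interior (in the sphere). -/
structure IsConvexBody (C : Set (Sph d)) : Prop where
  convex : IsConvex C
  closed : IsClosed C
  interior_nonempty : (interior C).Nonempty

/-- The hemisphere `H(m)` with center `m`. -/
def hemisphere (m : Sph d) : Set (Sph d) := {x | sdist x m ≤ Real.pi / 2}

/-- The hemisphere with center `k` supports `C`: it contains `C`, and the boundaries of `C` and
of the hemisphere have a common point. -/
def Supports (k : Sph d) (C : Set (Sph d)) : Prop :=
  C ⊆ hemisphere k ∧ (frontier C ∩ frontier (hemisphere k)).Nonempty

/-- The `(d-1)`-dimensional great sphere orthogonal to `n`. -/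
def greatSphere (n : Sph d) : Set (Sph d) :=
  {x | inner ℝ (n : EuclideanSpace ℝ (Fin (d + 1))) (x : EuclideanSpace ℝ (Fin (d + 1))) = 0}

/-- `A` is a `(d-1)`-dimensional hemisphere with center `c`: the set of points of a
`(d-1)`-dimensional great sphere through `c` at distance at most `π/2` from `c`. -/
def IsSubhemisphereWithCenter (A : Set (Sph d)) (c : Sph d) : Prop :=
  ∃ n : Sph d, c ∈ greatSphere n ∧ A = {x | x ∈ greatSphere n ∧ sdist x c ≤ Real.pi / 2}

/-- The hemispheres with centers `g` and `h` are different and not opposite, so that their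
intersection is a lune. -/
def FormLune (g h : Sph d) : Prop := g ≠ h ∧ g ≠ -h

/-- For `G = H(g)` and `H = H(h)`, the part `G/H` of the boundary of the lune `G ∩ H` that lies in
the boundary of `G`. -/
def luneFace (g h : Sph d) : Set (Sph d) := frontier (hemisphere g) ∩ hemisphere h

/-- `t` is the thickness of the lune `G ∩ H`, where `G = H(g)` and `H = H(h)`: the spherical
distance of the centers of the `(d-1)`-dimensional hemispheres `G/H` and `H/G` bounding it. -/
def IsLuneThickness (g h : Sph d) (t : ℝ) : Prop :=
  FormLune g h ∧ ∃ a b : Sph d, IsSubhemisphereWithCenter (luneFace g h) a ∧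
    IsSubhemisphereWithCenter (luneFace h g) b ∧ t = sdist a b

/-- The width of `C` determined by its supporting hemisphere with center `k`: the smallest
thickness of a lune formed by this hemisphere and another hemisphere supporting `C`. -/
def width (k : Sph d) (C : Set (Sph d)) : ℝ :=
  sInf {t : ℝ | ∃ k' : Sph d, Supports k' C ∧ IsLuneThickness k k' t}

/-- `W` is a body of constant width `w`: a convex body whose width determined by every supporting
hemisphere equals `w`. -/
def IsBodyOfConstantWidth (W : Set (Sph d)) (w : ℝ) : Prop :=
  IsConvexBody W ∧ ∀ k : Sph d, Supports k W → width k W = w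

/-- The diameter of `C` with respect to the spherical distance. -/
def sdiam (C : Set (Sph d)) : ℝ :=
  sSup {t : ℝ | ∃ a ∈ C, ∃ b ∈ C, t = sdist a b}

end SphericalConvex

end

/-!
Let `c = -cos w`. The unit normals of the hemispheres supporting `W` form the boundary `S` of the
dual body, and the thickness of the lune with normals `k` and `m` is `π` minus the angle between
them; so constant width `w` says that every point of `S` has its farthest point of `S` at angle
`arccos c = π - w`.

Let `a`, `b` be points of `W` at maximal distance. The great spheres through `b` and through `a`
orthogonal to the arc `ab` support `W`, and their normals `p` and `q` satisfy `⟪p, q⟫ = -⟪a, b⟫`.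
Hence `⟪a, b⟫ ≤ -c`. The reverse inequality uses that `⟪p, b⟫ = 0`.

* If `c < 0`, then `⟪p, m⟫ = c` for some `m ∈ S`. Since `W` has no point in `S`, its diameter is at
  most `π / 2`, and expanding `⟪p, m⟫` in terms of `⟪a, m⟫` and `⟪b, m⟫` gives the inequality.
* If `0 ≤ c`, then the dual body is the intersection of the balls of radius `arccos c` around the
  points of `S`. As for complete bodies in Euclidean space, this forces the point
  `c • p + √(1 - c ^ 2) • b`, at distance `arccos c` from `p` in the normal direction `b`, to lie in
  the dual body; so it has a nonnegative inner product with `a`.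
-/

open NormedSpace Topology
open scoped RealInnerProductSpace

namespace SphericalConvex

section UnitVectors

variable {E : Type*} [NormedAddCommGroup E] [InnerProductSpace ℝ E]

theorem inner_normalize_left (x y : E) : ⟪normalize x, y⟫ = ‖x‖⁻¹ * ⟪x, y⟫ :=
  real_inner_smul_left _ _ _

theorem norm_mul_inner_normalize_right (x y : E) : ‖y‖ * ⟪x, normalize y⟫ = ⟪x, y⟫ := by
  rw [← real_inner_smul_right, norm_smul_normalize]

theorem inner_sq_lt_one {a b : E} (ha : ‖a‖ = 1) (hb : ‖b‖ = 1) (hne : a ≠ b) (hne' : a ≠ -b) :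
    ⟪a, b⟫ ^ 2 < 1 := by
  have hlt : ⟪a, b⟫ < 1 := (inner_lt_one_iff_real_of_norm_eq_one ha hb).2 hne
  have hgt : ⟪a, -b⟫ < 1 :=
    (inner_lt_one_iff_real_of_norm_eq_one ha (by rwa [norm_neg])).2 hne'
  rw [inner_neg_right] at hgt
  nlinarith

theorem add_smul_ne_zero_of_ne_neg {a b : E} (ha : ‖a‖ = 1) (hb : ‖b‖ = 1) (hne : a ≠ -b) {t : ℝ}
    (ht : 0 ≤ t) : a + t • b ≠ 0 := by
  intro h
  have hab : a = -(t • b) := eq_neg_of_add_eq_zero_left h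
  have ht1 : 1 = t := by
    rw [← ha, hab, norm_neg, norm_smul, hb, mul_one, Real.norm_of_nonneg ht]
  rw [← ht1, one_smul] at hab
  exact hne hab

theorem norm_add_smul_le {p : E} (hp : ‖p‖ = 1) (y : E) (t : ℝ) :
    ‖p + t • y‖ ≤ 1 + t * ⟪p, y⟫ + t ^ 2 * ‖y‖ ^ 2 / 2 := by
  have hsq : ‖p + t • y‖ ^ 2 = 1 + 2 * (t * ⟪p, y⟫) + t ^ 2 * ‖y‖ ^ 2 := by
    rw [norm_add_sq_real, hp, real_inner_smul_right, norm_smul, mul_pow, Real.norm_eq_abs, sq_abs,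
      one_pow]
  linarith [two_mul_le_add_sq ‖p + t • y‖ 1]

theorem inner_sq_add_inner_sq_le_one {p b m : E} (hp : ‖p‖ = 1) (hb : ‖b‖ = 1) (hm : ‖m‖ = 1)
    (hpb : ⟪p, b⟫ = 0) : ⟪m, p⟫ ^ 2 + ⟪m, b⟫ ^ 2 ≤ 1 := by
  have hbp : ⟪b, p⟫ = 0 := by rw [real_inner_comm, hpb]
  have hsq : ⟪m - ⟪m, p⟫ • p - ⟪m, b⟫ • b, m - ⟪m, p⟫ • p - ⟪m, b⟫ • b⟫ =
      1 - ⟪m, p⟫ ^ 2 - ⟪m, b⟫ ^ 2 := by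
    simp only [inner_sub_left, inner_sub_right, real_inner_smul_left, real_inner_smul_right,
      inner_self_eq_one_of_norm_eq_one, hp, hb, hm, hpb, hbp, real_inner_comm m p,
      real_inner_comm m b]
    ring
  linarith [real_inner_self_nonneg (x := m - ⟪m, p⟫ • p - ⟪m, b⟫ • b)]

theorem norm_smul_add_smul_eq_one {p b : E} (hp : ‖p‖ = 1) (hb : ‖b‖ = 1) (hpb : ⟪p, b⟫ = 0)
    {c s : ℝ} (hcs : c ^ 2 + s ^ 2 = 1) : ‖c • p + s • b‖ = 1 := by
  rw [← pow_eq_one_iff_of_nonneg (norm_nonneg _) two_ne_zero, norm_add_sq_real, norm_smul,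
    norm_smul, hp, hb, real_inner_smul_left, real_inner_smul_right, hpb, mul_one, mul_one,
    Real.norm_eq_abs, Real.norm_eq_abs, sq_abs, sq_abs]
  linarith

/-- The unit tangent vector at `b` of the great-circle arc from `b` to `a`, for unit vectors `a`
and `b`. It has the junk value `0` if `a = b` or `a = -b`. -/
noncomputable def arcDirection (b a : E) : E :=
  (√(1 - ⟪a, b⟫ ^ 2))⁻¹ • (a - ⟪a, b⟫ • b)

theorem inner_arcDirection_left (b a x : E) :
    ⟪arcDirection b a, x⟫ = (√(1 - ⟪a, b⟫ ^ 2))⁻¹ * (⟪a, x⟫ - ⟪a, b⟫ * ⟪b, x⟫) := by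
  rw [arcDirection, real_inner_smul_left, inner_sub_left, real_inner_smul_left]

variable {a b : E}

theorem inner_arcDirection_of_inner_eq_zero {n : E} (ha : ⟪n, a⟫ = 0) (hb : ⟪n, b⟫ = 0) :
    ⟪n, arcDirection b a⟫ = 0 := by
  rw [arcDirection, real_inner_smul_right, inner_sub_right, real_inner_smul_right, ha, hb,
    mul_zero, sub_zero, mul_zero]

theorem inner_arcDirection_source (a : E) (hb : ‖b‖ = 1) : ⟪arcDirection b a, b⟫ = 0 := by
  rw [inner_arcDirection_left, inner_self_eq_one_of_norm_eq_one hb]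
  ring

theorem inner_arcDirection_target (b : E) (ha : ‖a‖ = 1) :
    ⟪arcDirection b a, a⟫ = √(1 - ⟪a, b⟫ ^ 2) := by
  rw [inner_arcDirection_left, inner_self_eq_one_of_norm_eq_one ha, real_inner_comm b a, ← pow_two,
    inv_mul_eq_div, Real.div_sqrt]

theorem norm_arcDirection (ha : ‖a‖ = 1) (hb : ‖b‖ = 1) (hab : ⟪a, b⟫ ^ 2 < 1) :
    ‖arcDirection b a‖ = 1 := by
  have hsin : √(1 - ⟪a, b⟫ ^ 2) ≠ 0 := (Real.sqrt_pos.2 (sub_pos.2 hab)).ne'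
  have hsource : ⟪b, arcDirection b a⟫ = 0 := by
    rw [real_inner_comm, inner_arcDirection_source a hb]
  have htarget : ⟪a, arcDirection b a⟫ = √(1 - ⟪a, b⟫ ^ 2) := by
    rw [real_inner_comm, inner_arcDirection_target b ha]
  have hself : ⟪arcDirection b a, arcDirection b a⟫ = 1 := by
    rw [inner_arcDirection_left, hsource, htarget, mul_zero, sub_zero, inv_mul_cancel₀ hsin]
  rwa [real_inner_self_eq_norm_sq, pow_eq_one_iff_of_nonneg (norm_nonneg _) two_ne_zero] at hself

theorem inner_arcDirection_arcDirection (ha : ‖a‖ = 1) (hb : ‖b‖ = 1) (hab : ⟪a, b⟫ ^ 2 < 1) :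
    ⟪arcDirection b a, arcDirection a b⟫ = -⟪a, b⟫ := by
  have hsin : √(1 - ⟪a, b⟫ ^ 2) ≠ 0 := (Real.sqrt_pos.2 (sub_pos.2 hab)).ne'
  have hsource : ⟪a, arcDirection a b⟫ = 0 := by
    rw [real_inner_comm, inner_arcDirection_source b ha]
  have htarget : ⟪b, arcDirection a b⟫ = √(1 - ⟪a, b⟫ ^ 2) := by
    rw [real_inner_comm, inner_arcDirection_target a hb, real_inner_comm a b]
  rw [inner_arcDirection_left, hsource, htarget]
  field_simp
  ring

end UnitVectors

section DualBody

variable {E : Type*} [NormedAddCommGroup E] [InnerProductSpace ℝ E]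

/-- A spherical convex body, seen as a set of unit vectors of an inner product space. That the body
has interior points is encoded, as for convex cones in finite dimension, by the requirement that it
is not contained in a hyperplane through the origin. -/
structure IsSphericalBody (W : Set E) : Prop where
  norm_eq_one : ∀ x ∈ W, ‖x‖ = 1
  isCompact : IsCompact W
  nonempty : W.Nonempty
  neg_notMem : ∀ x ∈ W, -x ∉ W
  smul_add_smul_mem : ∀ a ∈ W, ∀ b ∈ W, ∀ s t : ℝ, 0 ≤ s → 0 ≤ t → ‖s • a + t • b‖ = 1 →
    s • a + t • b ∈ W
  eq_zero_of_forall_inner_eq_zero : ∀ k : E, (∀ x ∈ W, ⟪k, x⟫ = 0) → k = 0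

/-- The dual body of `W`: the unit vectors `k` whose hemisphere `0 ≤ ⟪k, x⟫` contains `W`. -/
def dualBody (W : Set E) : Set E := {k | ‖k‖ = 1 ∧ ∀ x ∈ W, 0 ≤ ⟪k, x⟫}

/-- The boundary of the dual body of `W`: the unit vectors `k` whose hemisphere `0 ≤ ⟪k, x⟫`
supports `W`. -/
def dualBoundary (W : Set E) : Set E := {k ∈ dualBody W | ∃ x ∈ W, ⟪k, x⟫ = 0}

/-- Every point of the set `S` of unit vectors has a farthest point in `S`, at angle `arccos c`. The
angle is encoded by its cosine, so that a larger inner product means a smaller distance. -/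
structure HasConstantDiameter (S : Set E) (c : ℝ) : Prop where
  le_inner : ∀ k ∈ S, ∀ m ∈ S, c ≤ ⟪k, m⟫
  exists_inner_eq : ∀ k ∈ S, ∃ m ∈ S, ⟪k, m⟫ = c

theorem normalize_mem_dualBoundary {W : Set E} {z : E} (hz : z ≠ 0) (hnonneg : ∀ y ∈ W, 0 ≤ ⟪z, y⟫)
    (hzero : ∃ y ∈ W, ⟪z, y⟫ = 0) : normalize z ∈ dualBoundary W := by
  obtain ⟨y, hy, hzy⟩ := hzero
  refine ⟨⟨norm_normalize_eq_one_iff.2 hz, fun x hx => ?_⟩, y, hy, ?_⟩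
  · rw [inner_normalize_left]
    exact mul_nonneg (by positivity) (hnonneg x hx)
  · rw [inner_normalize_left, hzy, mul_zero]

theorem isCompact_dualBoundary [FiniteDimensional ℝ E] {W : Set E} (hW : IsCompact W) :
    IsCompact (dualBoundary W) := by
  have : ProperSpace E := FiniteDimensional.proper ℝ E
  let incidence : Set (E × E) := {p | ⟪p.1, p.2⟫ = 0} ∩ ⋂ x ∈ W, {p | 0 ≤ ⟪p.1, x⟫}
  have hclosed : IsClosed incidence :=
    (isClosed_eq (by fun_prop) (by fun_prop)).inter
      (isClosed_biInter fun x _ => isClosed_le (by fun_prop) (by fun_prop))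
  have heq : dualBoundary W = Prod.fst '' (Metric.sphere (0 : E) 1 ×ˢ W ∩ incidence) := by
    ext k
    simp only [dualBoundary, dualBody, incidence, Set.mem_image, Set.mem_inter_iff, Set.mem_prod,
      mem_sphere_zero_iff_norm, Set.mem_ofPred_eq, Set.mem_iInter, Prod.exists,
      exists_and_right, exists_eq_right]
    grind
  rw [heq]
  exact (((isCompact_sphere 0 1).prod hW).inter_right hclosed).image continuous_fst

namespace IsSphericalBody

variable {W : Set E}

theorem ne_neg (hW : IsSphericalBody W) {x y : E} (hx : x ∈ W) (hy : y ∈ W) : x ≠ -y :=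
  fun h => hW.neg_notMem y hy (h ▸ hx)

theorem inner_sq_lt_one (hW : IsSphericalBody W) {x y : E} (hx : x ∈ W) (hy : y ∈ W)
    (hne : x ≠ y) : ⟪x, y⟫ ^ 2 < 1 :=
  SphericalConvex.inner_sq_lt_one (hW.norm_eq_one x hx) (hW.norm_eq_one y hy) hne (hW.ne_neg hx hy)

theorem add_smul_ne_zero (hW : IsSphericalBody W) {a b : E} (ha : a ∈ W) (hb : b ∈ W) {t : ℝ}
    (ht : 0 ≤ t) : a + t • b ≠ 0 :=
  add_smul_ne_zero_of_ne_neg (hW.norm_eq_one a ha) (hW.norm_eq_one b hb) (hW.ne_neg ha hb) ht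

theorem normalize_add_smul_mem (hW : IsSphericalBody W) {a b : E} (ha : a ∈ W) (hb : b ∈ W)
    {t : ℝ} (ht : 0 ≤ t) : normalize (a + t • b) ∈ W := by
  have hnorm : ‖normalize (a + t • b)‖ = 1 :=
    norm_normalize_eq_one_iff.2 (hW.add_smul_ne_zero ha hb ht)
  rw [NormedSpace.normalize, smul_add, smul_smul] at hnorm ⊢
  exact hW.smul_add_smul_mem a ha b hb _ _ (by positivity) (by positivity) hnorm

/-- The first-order condition for a minimum, obtained by moving from `y` a little towards `z`. -/
theorem inner_mul_inner_le_of_isMinOn (hW : IsSphericalBody W) {k y z : E} (hy : y ∈ W)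
    (hmin : IsMinOn (fun x => ⟪k, x⟫) W y) (hz : z ∈ W) : ⟪k, y⟫ * ⟪y, z⟫ ≤ ⟪k, z⟫ := by
  refine le_of_forall_pos_le_add fun ε hε => ?_
  obtain ⟨t, ht, htε⟩ := exists_pos_mul_lt hε (|⟪k, y⟫| / 2)
  set c := ⟪k, y⟫
  set g := ⟪y, z⟫
  set N := ‖y + t • z‖
  have hpoint : c * N ≤ c + t * ⟪k, z⟫ := by
    have hle : c ≤ ⟪k, normalize (y + t • z)⟫ := hmin (hW.normalize_add_smul_mem hy hz ht.le)
    have := mul_le_mul_of_nonneg_left hle (norm_nonneg (y + t • z))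
    rw [norm_mul_inner_normalize_right, inner_add_right, real_inner_smul_right] at this
    linarith
  have hlower : 1 + t * g ≤ N := by
    have := real_inner_le_norm y (y + t • z)
    rwa [inner_add_right, real_inner_smul_right, hW.norm_eq_one y hy, one_mul,
      inner_self_eq_one_of_norm_eq_one (hW.norm_eq_one y hy)] at this
  have hupper : N ≤ 1 + t * g + t ^ 2 / 2 := by
    simpa [hW.norm_eq_one z hz] using norm_add_smul_le (hW.norm_eq_one y hy) z t
  have herror : -(|c| * (t ^ 2 / 2)) ≤ c * (N - (1 + t * g)) := by
    have habs : |N - (1 + t * g)| ≤ t ^ 2 / 2 := abs_le.2 ⟨by nlinarith, by linarith⟩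
    refine (abs_le.1 ?_).1
    rw [abs_mul]
    gcongr
  have hscaled : t * (c * g) ≤ t * (⟪k, z⟫ + ε) := by nlinarith
  exact le_of_mul_le_mul_left hscaled ht

theorem arcDirection_mem_dualBoundary (hW : IsSphericalBody W) {a b : E} (ha : a ∈ W) (hb : b ∈ W)
    (hne : a ≠ b) (hmin : IsMinOn (fun x => ⟪a, x⟫) W b) : arcDirection b a ∈ dualBoundary W := by
  have ha1 := hW.norm_eq_one a ha
  have hb1 := hW.norm_eq_one b hb
  refine ⟨⟨norm_arcDirection ha1 hb1 (hW.inner_sq_lt_one ha hb hne), fun z hz => ?_⟩,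
    b, hb, inner_arcDirection_source a hb1⟩
  rw [inner_arcDirection_left]
  exact mul_nonneg (by positivity) (sub_nonneg.2 (hW.inner_mul_inner_le_of_isMinOn hb hmin hz))

theorem exists_ne_inner_minimal (hW : IsSphericalBody W) (hnt : W.Nontrivial) :
    ∃ a ∈ W, ∃ b ∈ W, a ≠ b ∧ ∀ x ∈ W, ∀ y ∈ W, ⟪a, b⟫ ≤ ⟪x, y⟫ := by
  have hcont : ContinuousOn (fun p : E × E => ⟪p.1, p.2⟫) (W ×ˢ W) := by fun_prop
  obtain ⟨⟨a, b⟩, ⟨ha, hb⟩, hmin⟩ :=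
    (hW.isCompact.prod hW.isCompact).exists_isMinOn (hW.nonempty.prod hW.nonempty) hcont
  have hle : ∀ x ∈ W, ∀ y ∈ W, ⟪a, b⟫ ≤ ⟪x, y⟫ := fun x hx y hy => hmin (Set.mk_mem_prod hx hy)
  refine ⟨a, ha, b, hb, ?_, hle⟩
  rintro rfl
  obtain ⟨x, hx, y, hy, hxy⟩ := hnt
  have hlt := (inner_lt_one_iff_real_of_norm_eq_one (hW.norm_eq_one x hx)
    (hW.norm_eq_one y hy)).2 hxy
  rw [← inner_self_eq_one_of_norm_eq_one (𝕜 := ℝ) (hW.norm_eq_one a ha)] at hlt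
  exact hlt.not_ge (hle x hx y hy)

theorem exists_dualBoundary_inner_eq_neg (hW : IsSphericalBody W) {a b : E} (ha : a ∈ W)
    (hb : b ∈ W) (hne : a ≠ b) (hmin : ∀ x ∈ W, ∀ y ∈ W, ⟪a, b⟫ ≤ ⟪x, y⟫) :
    ∃ p ∈ dualBoundary W, ∃ q ∈ dualBoundary W, ⟪p, q⟫ = -⟪a, b⟫ :=
  ⟨_, hW.arcDirection_mem_dualBoundary ha hb hne fun x hx => hmin a ha x hx,
    _, hW.arcDirection_mem_dualBoundary hb ha hne.symm fun x hx =>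
      (real_inner_comm a b).trans_le (hmin b hb x hx),
    inner_arcDirection_arcDirection (hW.norm_eq_one a ha) (hW.norm_eq_one b hb)
      (hW.inner_sq_lt_one ha hb hne)⟩

theorem dualBoundary_nontrivial (hW : IsSphericalBody W) (hnt : W.Nontrivial) :
    (dualBoundary W).Nontrivial := by
  obtain ⟨a, ha, b, hb, hne, hmin⟩ := hW.exists_ne_inner_minimal hnt
  obtain ⟨p, hp, q, hq, hpq⟩ := hW.exists_dualBoundary_inner_eq_neg ha hb hne hmin
  refine ⟨p, hp, q, hq, ?_⟩
  rintro rfl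
  rw [inner_self_eq_one_of_norm_eq_one hp.1.1] at hpq
  nlinarith [hW.inner_sq_lt_one ha hb hne]

theorem neg_notMem_dualBody (hW : IsSphericalBody W) {k : E} (hk : k ∈ dualBody W) :
    -k ∉ dualBody W := by
  intro hneg
  have hzero : k = 0 := hW.eq_zero_of_forall_inner_eq_zero k fun x hx => by
    have hle := hneg.2 x hx
    rw [inner_neg_left] at hle
    linarith [hk.2 x hx]
  simpa [hzero] using hk.1

theorem nontrivial_of_one_lt_finrank (hW : IsSphericalBody W)
    (hE : 1 < Module.finrank ℝ E) : W.Nontrivial := by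
  by_contra hsub
  obtain ⟨x, hx⟩ := hW.nonempty
  have hinj : Function.Injective (innerₗ E x) := by
    refine (injective_iff_map_eq_zero _).2 fun k hk => ?_
    refine hW.eq_zero_of_forall_inner_eq_zero k fun y hy => ?_
    rw [Set.not_nontrivial_iff.1 hsub hy hx, real_inner_comm]
    exact hk
  have := LinearMap.finrank_le_finrank_of_injective hinj
  rw [Module.finrank_self] at this
  omega

theorem exists_forall_inner_nonneg_and_inner_pos (hW : IsSphericalBody W) {y : E} (hy : y ∈ W) :
    ∃ o ∈ W, (∀ x ∈ W, 0 ≤ ⟪o, x⟫) ∧ 0 < ⟪o, y⟫ := by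
  have hyy := inner_self_eq_one_of_norm_eq_one (𝕜 := ℝ) (hW.norm_eq_one y hy)
  obtain ⟨x, hx, hmin⟩ := hW.isCompact.exists_isMinOn hW.nonempty
    (f := fun x => ⟪y, x⟫) (by fun_prop)
  rcases le_or_gt 0 ⟪y, x⟫ with hyx | hyx
  · exact ⟨y, hy, fun z hz => hyx.trans (hmin hz), by rw [hyy]; exact one_pos⟩
  have hne : y ≠ x := by
    rintro rfl
    linarith
  have hpos : 0 < ‖y + (-⟪y, x⟫) • x‖⁻¹ :=
    inv_pos.2 (norm_pos_iff.2 (hW.add_smul_ne_zero hy hx (by linarith)))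
  refine ⟨_, hW.normalize_add_smul_mem hy hx (t := -⟪y, x⟫) (by linarith), fun z hz => ?_, ?_⟩
  · have := hW.inner_mul_inner_le_of_isMinOn hx hmin hz
    rw [inner_normalize_left, inner_add_left, real_inner_smul_left]
    exact mul_nonneg hpos.le (by linarith)
  · have := hW.inner_sq_lt_one hy hx hne
    rw [inner_normalize_left, inner_add_left, real_inner_smul_left, hyy, real_inner_comm y x]
    exact mul_pos hpos (by linarith)

/-- Normalized sums of points of `W` in the dual body are again such points, so by compactness one
of them serves all `y`. -/
theorem exists_mem_forall_inner_pos (hW : IsSphericalBody W) :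
    ∃ o ∈ W, ∀ y ∈ W, 0 < ⟪o, y⟫ := by
  suffices hlocal : ∃ o ∈ W, (∀ x ∈ W, 0 ≤ ⟪o, x⟫) ∧ ∀ y ∈ W, y ∈ W → 0 < ⟪o, y⟫ by
    obtain ⟨o, hoW, -, ho⟩ := hlocal
    exact ⟨o, hoW, fun y hy => ho y hy hy⟩
  refine hW.isCompact.induction_on
    (p := fun s => ∃ o ∈ W, (∀ x ∈ W, 0 ≤ ⟪o, x⟫) ∧ ∀ y ∈ s, y ∈ W → 0 < ⟪o, y⟫) ?_ ?_ ?_ ?_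
  · obtain ⟨y, hy⟩ := hW.nonempty
    obtain ⟨o, hoW, ho, -⟩ := hW.exists_forall_inner_nonneg_and_inner_pos hy
    exact ⟨o, hoW, ho, by simp⟩
  · rintro s t hst ⟨o, hoW, ho, hpos⟩
    exact ⟨o, hoW, ho, fun y hy => hpos y (hst hy)⟩
  · rintro s t ⟨o, hoW, ho, hpos⟩ ⟨o', hoW', ho', hpos'⟩
    have hinv : 0 < ‖o + (1 : ℝ) • o'‖⁻¹ :=
      inv_pos.2 (norm_pos_iff.2 (hW.add_smul_ne_zero hoW hoW' zero_le_one))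
    refine ⟨_, hW.normalize_add_smul_mem hoW hoW' zero_le_one, fun x hx => ?_, fun y hy hyW => ?_⟩
    all_goals rw [inner_normalize_left, one_smul, inner_add_left]
    all_goals rw [one_smul] at hinv
    · exact mul_nonneg hinv.le (add_nonneg (ho x hx) (ho' x hx))
    · refine mul_pos hinv ?_
      rcases hy with hy | hy
      · exact add_pos_of_pos_of_nonneg (hpos y hy hyW) (ho' y hyW)
      · exact add_pos_of_nonneg_of_pos (ho y hyW) (hpos' y hy hyW)
  · intro y hy
    obtain ⟨o, hoW, ho, hpos⟩ := hW.exists_forall_inner_nonneg_and_inner_pos hy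
    have hopen : IsOpen {x : E | 0 < ⟪o, x⟫} := isOpen_lt (by fun_prop) (by fun_prop)
    exact ⟨_, mem_nhdsWithin_of_mem_nhds (hopen.mem_nhds hpos), o, hoW, ho, fun x hx _ => hx⟩

theorem exists_add_smul_boundary (hW : IsSphericalBody W) {o z : E} (ho : ∀ y ∈ W, 0 < ⟪o, y⟫)
    (hz : ∃ y ∈ W, ⟪z, y⟫ < 0) :
    ∃ t : ℝ, 0 < t ∧ (∀ y ∈ W, 0 ≤ ⟪o + t • z, y⟫) ∧ ∃ y ∈ W, ⟪o + t • z, y⟫ = 0 := by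
  have hcont : ContinuousOn (fun y => ⟪z, y⟫ / ⟪o, y⟫) W :=
    ContinuousOn.div (by fun_prop) (by fun_prop) fun y hy => (ho y hy).ne'
  obtain ⟨y₀, hy₀, hmin⟩ := hW.isCompact.exists_isMinOn hW.nonempty hcont
  obtain ⟨y₁, hy₁, hneg⟩ := hz
  set M := ⟪z, y₀⟫ / ⟪o, y₀⟫ with hM
  have hMneg : M < 0 := (hmin hy₁).trans_lt (div_neg_of_neg_of_pos hneg (ho y₁ hy₁))
  have hexpand : ∀ y ∈ W, ⟪o + (-M)⁻¹ • z, y⟫ = (-M)⁻¹ * ⟪o, y⟫ * (⟪z, y⟫ / ⟪o, y⟫ - M) := by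
    intro y hy
    have := (ho y hy).ne'
    rw [inner_add_left, real_inner_smul_left]
    field_simp [hMneg.ne]
    ring
  have hpos : 0 < (-M)⁻¹ := inv_pos.2 (neg_pos.2 hMneg)
  refine ⟨(-M)⁻¹, hpos, fun y hy => ?_, y₀, hy₀, ?_⟩
  · rw [hexpand y hy]
    exact mul_nonneg (mul_nonneg hpos.le (ho y hy).le) (sub_nonneg.2 (hmin hy))
  · rw [hexpand y₀ hy₀, ← hM, sub_self, mul_zero]

variable {c : ℝ}

theorem inner_nonneg_of_neg (hW : IsSphericalBody W) (hc : c < 0)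
    (hS : HasConstantDiameter (dualBoundary W) c) {x y : E} (hx : x ∈ W) (hy : y ∈ W) :
    0 ≤ ⟪x, y⟫ := by
  by_contra! hneg
  obtain ⟨o, hoW, ho⟩ := hW.exists_mem_forall_inner_pos
  obtain ⟨t, ht, hnonneg, hzero⟩ := hW.exists_add_smul_boundary ho ⟨y, hy, hneg⟩
  have hn : normalize (o + t • x) ∈ dualBoundary W :=
    normalize_mem_dualBoundary (hW.add_smul_ne_zero hoW hx ht.le) hnonneg hzero
  obtain ⟨m, hm, hnm⟩ := hS.exists_inner_eq _ hn
  have hle := hm.1.2 _ (hW.normalize_add_smul_mem hoW hx ht.le)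
  rw [real_inner_comm, hnm] at hle
  exact hc.not_ge hle

theorem neg_le_inner_of_neg (hW : IsSphericalBody W) (hc : c < 0)
    (hS : HasConstantDiameter (dualBoundary W) c) {a b : E} (ha : a ∈ W) (hb : b ∈ W) (hne : a ≠ b)
    (hmin : IsMinOn (fun x => ⟪a, x⟫) W b) : -c ≤ ⟪a, b⟫ := by
  have hb1 := hW.norm_eq_one b hb
  have hab := hW.inner_sq_lt_one ha hb hne
  have hp := hW.arcDirection_mem_dualBoundary ha hb hne hmin
  obtain ⟨m, hm, hpm⟩ := hS.exists_inner_eq _ hp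
  have hbessel := inner_sq_add_inner_sq_le_one hp.1.1 hb1 hm.1.1 (inner_arcDirection_source a hb1)
  rw [real_inner_comm, hpm] at hbessel
  set g := ⟪a, b⟫
  have hg : 0 ≤ g := hW.inner_nonneg_of_neg hc hS ha hb
  have hsin : 0 < √(1 - g ^ 2) := Real.sqrt_pos.2 (sub_pos.2 hab)
  rw [inner_arcDirection_left, inv_mul_eq_iff_eq_mul₀ hsin.ne', real_inner_comm m a,
    real_inner_comm m b] at hpm
  have hle : √(1 - g ^ 2) * -c ≤ g * ⟪m, b⟫ := by linarith [hm.1.2 a ha]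
  have hsq := pow_le_pow_left₀ (mul_nonneg hsin.le (by linarith)) hle 2
  rw [mul_pow, mul_pow, Real.sq_sqrt (by linarith)] at hsq
  nlinarith [mul_le_mul_of_nonneg_left hbessel (sq_nonneg g)]

theorem mul_norm_lt_inner_of_forall_pos (hW : IsSphericalBody W) (hc : 0 ≤ c) (hc1 : c < 1)
    (hS : HasConstantDiameter (dualBoundary W) c) {o k : E} (ho : ∀ y ∈ W, 0 < ⟪o, y⟫)
    (hk : k ∈ dualBoundary W) : c * ‖o‖ < ⟪k, o⟫ := by
  obtain ⟨⟨hk1, hkW⟩, x, hx, hkx⟩ := hk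
  have hexit : ∃ y ∈ W, ⟪-k, y⟫ < 0 := by
    by_contra! hall
    have hzero : k = 0 := hW.eq_zero_of_forall_inner_eq_zero k fun y hy =>
      le_antisymm (by simpa only [inner_neg_left, neg_nonneg] using hall y hy) (hkW y hy)
    simp [hzero] at hk1
  obtain ⟨t, ht, hnonneg, hzero⟩ := hW.exists_add_smul_boundary ho hexit
  set n := o + t • -k with hn
  have hn0 : n ≠ 0 := by
    intro h
    have : ⟪n, x⟫ = ⟪o, x⟫ := by
      rw [hn, inner_add_left, real_inner_smul_left, inner_neg_left, hkx, neg_zero, mul_zero,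
        add_zero]
    rw [h, inner_zero_left] at this
    exact (ho x hx).ne this
  have hfar : c * ‖n‖ ≤ ⟪k, n⟫ := by
    rw [← norm_mul_inner_normalize_right, mul_comm]
    gcongr
    exact hS.le_inner k ⟨⟨hk1, hkW⟩, x, hx, hkx⟩ _ (normalize_mem_dualBoundary hn0 hnonneg hzero)
  have hkn : ⟪k, n⟫ = ⟪k, o⟫ - t := by
    rw [hn, inner_add_right, real_inner_smul_right, inner_neg_right,
      inner_self_eq_one_of_norm_eq_one hk1]
    ring
  have htri : ‖o‖ ≤ ‖n‖ + t := by
    have hno : n + t • k = o := by rw [hn, smul_neg, neg_add_cancel_right]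
    have := norm_add_le n (t • k)
    rwa [hno, norm_smul, hk1, mul_one, Real.norm_of_nonneg ht.le] at this
  nlinarith [mul_le_mul_of_nonneg_left htri hc, mul_pos ht (sub_pos.2 hc1)]

/-- Otherwise some ray from an interior point of the dual cone in direction `z` leaves this cone at
a vector whose angle with every point of the dual boundary is less than `arccos c`. -/
theorem inner_nonneg_of_forall_mul_norm_le (hW : IsSphericalBody W) (hc : 0 ≤ c) (hc1 : c < 1)
    (hS : HasConstantDiameter (dualBoundary W) c) (hne : (dualBoundary W).Nonempty) {z y : E}
    (hz : ∀ m ∈ dualBoundary W, c * ‖z‖ ≤ ⟪m, z⟫) (hy : y ∈ W) : 0 ≤ ⟪z, y⟫ := by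
  by_contra! hneg
  obtain ⟨o, -, ho⟩ := hW.exists_mem_forall_inner_pos
  obtain ⟨t, ht, hnonneg, hzero⟩ := hW.exists_add_smul_boundary ho ⟨y, hy, hneg⟩
  obtain ⟨m, hm, heq⟩ : ∃ m ∈ dualBoundary W, ⟪m, o + t • z⟫ = c * ‖o + t • z‖ := by
    by_cases h0 : o + t • z = 0
    · obtain ⟨m, hm⟩ := hne
      exact ⟨m, hm, by rw [h0, inner_zero_right, norm_zero, mul_zero]⟩
    · obtain ⟨m, hm, hnm⟩ := hS.exists_inner_eq _ (normalize_mem_dualBoundary h0 hnonneg hzero)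
      refine ⟨m, hm, ?_⟩
      rw [← norm_mul_inner_normalize_right, real_inner_comm, hnm, mul_comm]
  have hlt : c * ‖o + t • z‖ < ⟪m, o + t • z⟫ :=
    calc c * ‖o + t • z‖ ≤ c * (‖o‖ + t * ‖z‖) := by
          gcongr
          simpa [norm_smul, abs_of_pos ht] using norm_add_le o (t • z)
      _ = c * ‖o‖ + t * (c * ‖z‖) := by ring
      _ < ⟪m, o⟫ + t * ⟪m, z⟫ :=
          add_lt_add_of_lt_of_le (hW.mul_norm_lt_inner_of_forall_pos hc hc1 hS ho hm)
            (mul_le_mul_of_nonneg_left (hz m hm) ht.le)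
      _ = ⟪m, o + t • z⟫ := by rw [inner_add_right, real_inner_smul_right]
  exact hlt.ne' heq

/-- Otherwise some vector `p + t • (s • k - r • b)` with small `t > 0` would satisfy the criterion
`inner_nonneg_of_forall_mul_norm_le` but have a negative inner product with `b`. -/
theorem le_inner_smul_add_smul (hW : IsSphericalBody W) (hc : 0 ≤ c)
    (hS : HasConstantDiameter (dualBoundary W) c) {s : ℝ} (hs : 0 < s) (hcs : c ^ 2 + s ^ 2 = 1)
    {p b k : E} (hp : p ∈ dualBoundary W) (hb : b ∈ W) (hpb : ⟪p, b⟫ = 0)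
    (hk : k ∈ dualBoundary W) : c ≤ ⟪k, c • p + s • b⟫ := by
  rw [inner_add_right, real_inner_smul_right, real_inner_smul_right]
  by_contra! hlt
  obtain ⟨r, hr, hrc⟩ := exists_between (show s * ⟪k, b⟫ < c * (1 - ⟪k, p⟫) by linarith)
  set y := s • k - r • b
  obtain ⟨t, ht, hty⟩ := exists_pos_mul_lt (mul_pos hs (sub_pos.2 hrc)) (c * ‖y‖ ^ 2 / 2)
  have hr0 : 0 ≤ r := (mul_nonneg hs.le (hk.1.2 b hb)).trans hr.le
  have hinner : ∀ m : E, ⟪m, p + t • y⟫ = ⟪m, p⟫ + t * (s * ⟪m, k⟫ - r * ⟪m, b⟫) := fun m => by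
    simp only [y, inner_add_right, inner_sub_right, real_inner_smul_right]
  have hcriterion : ∀ m ∈ dualBoundary W, c * ‖p + t • y‖ ≤ ⟪m, p + t • y⟫ := by
    intro m hm
    have hmp := hS.le_inner m hm p hp
    have hmb : ⟪m, b⟫ ≤ s := by
      have := inner_sq_add_inner_sq_le_one hp.1.1 (hW.norm_eq_one b hb) hm.1.1 hpb
      exact le_of_sq_le_sq (by nlinarith) hs.le
    have hpy : ⟪p, y⟫ = s * ⟪k, p⟫ := by
      simp only [y, inner_sub_right, real_inner_smul_right, hpb, real_inner_comm p k]
      ring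
    have hnorm := norm_add_smul_le hp.1.1 y t
    rw [hpy] at hnorm
    calc c * ‖p + t • y‖ ≤ c * (1 + t * (s * ⟪k, p⟫) + t ^ 2 * ‖y‖ ^ 2 / 2) := by gcongr
      _ = c + t * (s * (c * ⟪k, p⟫) + c * ‖y‖ ^ 2 / 2 * t) := by ring
      _ ≤ c + t * (s * c - r * s) := by gcongr; linarith
      _ ≤ ⟪m, p⟫ + t * (s * ⟪m, k⟫ - r * ⟪m, b⟫) := by
          gcongr
          exact hS.le_inner m hm k hk
      _ = ⟪m, p + t • y⟫ := (hinner m).symm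
  have hnonneg := hW.inner_nonneg_of_forall_mul_norm_le hc (by nlinarith) hS ⟨p, hp⟩ hcriterion hb
  rw [real_inner_comm, hinner, real_inner_comm, hpb, real_inner_comm k b,
    inner_self_eq_one_of_norm_eq_one (hW.norm_eq_one b hb)] at hnonneg
  nlinarith

theorem neg_le_inner_of_nonneg (hW : IsSphericalBody W) (hc : 0 ≤ c)
    (hS : HasConstantDiameter (dualBoundary W) c) {a b : E} (ha : a ∈ W) (hb : b ∈ W) (hne : a ≠ b)
    (hmin : IsMinOn (fun x => ⟪a, x⟫) W b) : -c ≤ ⟪a, b⟫ := by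
  by_contra! hlt
  have hb1 := hW.norm_eq_one b hb
  have hab := hW.inner_sq_lt_one ha hb hne
  have hc1 : c ^ 2 < 1 := by nlinarith
  have hp := hW.arcDirection_mem_dualBoundary ha hb hne hmin
  have hpb := inner_arcDirection_source a hb1
  have hpa := inner_arcDirection_target b (hW.norm_eq_one a ha)
  set p := arcDirection b a
  set g := ⟪a, b⟫
  set s := √(1 - c ^ 2)
  have hs : 0 < s := Real.sqrt_pos.2 (sub_pos.2 hc1)
  have hs2 : s ^ 2 = 1 - c ^ 2 := Real.sq_sqrt (sub_pos.2 hc1).le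
  have hnonneg : 0 ≤ ⟪c • p + s • b, a⟫ :=
    hW.inner_nonneg_of_forall_mul_norm_le hc (by nlinarith) hS ⟨p, hp⟩ (fun m hm => by
      rw [norm_smul_add_smul_eq_one hp.1.1 hb1 hpb (by linarith), mul_one]
      exact hW.le_inner_smul_add_smul hc hS hs (by linarith) hp hb hpb hm) ha
  rw [inner_add_left, real_inner_smul_left, real_inner_smul_left, hpa, real_inner_comm] at hnonneg
  have hle : s * -g ≤ c * √(1 - g ^ 2) := by linarith
  have hsq := pow_le_pow_left₀ (mul_nonneg hs.le (by linarith)) hle 2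
  rw [mul_pow, mul_pow, hs2, Real.sq_sqrt (sub_pos.2 hab).le] at hsq
  nlinarith

theorem isLeast_inner (hW : IsSphericalBody W) (hnt : W.Nontrivial)
    (hS : HasConstantDiameter (dualBoundary W) c) :
    IsLeast (Set.image2 (fun x y => ⟪x, y⟫) W W) (-c) := by
  obtain ⟨a, ha, b, hb, hne, hmin⟩ := hW.exists_ne_inner_minimal hnt
  obtain ⟨p, hp, q, hq, hpq⟩ := hW.exists_dualBoundary_inner_eq_neg ha hb hne hmin
  have hle : ⟪a, b⟫ ≤ -c := by linarith [hS.le_inner p hp q hq]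
  have hge : -c ≤ ⟪a, b⟫ := by
    rcases lt_or_ge c 0 with hc | hc
    · exact hW.neg_le_inner_of_neg hc hS ha hb hne fun x hx => hmin a ha x hx
    · exact hW.neg_le_inner_of_nonneg hc hS ha hb hne fun x hx => hmin a ha x hx
  exact ⟨⟨a, ha, b, hb, hle.antisymm hge⟩,
    Set.forall_mem_image2.2 fun x hx y hy => hge.trans (hmin x hx y hy)⟩

end IsSphericalBody

end DualBody

section Sphere

variable {d : ℕ}

theorem norm_coe (x : Sph d) : ‖x.1‖ = 1 :=
  norm_eq_of_mem_sphere x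

theorem sdist_eq_arccos (a b : Sph d) : sdist a b = Real.arccos ⟪a.1, b.1⟫ := by
  rw [sdist, InnerProductGeometry.angle, norm_coe, norm_coe, mul_one, div_one]

theorem mem_hemisphere_iff {x m : Sph d} : x ∈ hemisphere m ↔ 0 ≤ ⟪m.1, x.1⟫ := by
  rw [hemisphere, Set.mem_ofPred_eq, sdist_eq_arccos, Real.arccos_le_pi_div_two, real_inner_comm]

theorem isClosed_hemisphere (m : Sph d) : IsClosed (hemisphere m) := by
  have heq : hemisphere m = {x | 0 ≤ ⟪m.1, x.1⟫} := Set.ext fun x => mem_hemisphere_iff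
  rw [heq]
  exact isClosed_le (by fun_prop) (by fun_prop)

theorem exists_inner_neg_of_mem_nhds {k x : Sph d} (hkx : ⟪k.1, x.1⟫ = 0) {S : Set (Sph d)}
    (hS : S ∈ 𝓝 x) : ∃ z ∈ S, ⟪k.1, z.1⟫ < 0 := by
  let curve : ℝ → Sph d := fun t => ⟨Real.cos t • x.1 + Real.sin t • k.1,
    mem_sphere_zero_iff_norm.2 (norm_smul_add_smul_eq_one (norm_coe x) (norm_coe k)
      (by rw [real_inner_comm, hkx]) (Real.cos_sq_add_sin_sq t))⟩
  have hcurve : Continuous curve := by fun_prop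
  have hzero : curve 0 = x := Subtype.ext (by simp [curve])
  have hmem : ∀ᶠ t in 𝓝[<] 0, curve t ∈ S :=
    nhdsWithin_le_nhds (hcurve.continuousAt.eventually_mem (by rwa [hzero]))
  obtain ⟨t, htS, ht⟩ := (hmem.and (Ioo_mem_nhdsLT (neg_lt_zero.2 Real.pi_pos))).exists
  refine ⟨curve t, htS, ?_⟩
  have hinner : ⟪k.1, (curve t).1⟫ = Real.sin t := by
    simp only [curve, inner_add_right, real_inner_smul_right, hkx,
      inner_self_eq_one_of_norm_eq_one (norm_coe k), mul_zero, zero_add, mul_one]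
  rw [hinner]
  exact Real.sin_neg_of_neg_of_neg_pi_lt ht.2 ht.1

theorem notMem_interior_of_inner_eq_zero {C : Set (Sph d)} {k x : Sph d} (hC : C ⊆ hemisphere k)
    (hkx : ⟪k.1, x.1⟫ = 0) : x ∉ interior C := by
  intro hx
  obtain ⟨z, hz, hneg⟩ := exists_inner_neg_of_mem_nhds hkx (mem_interior_iff_mem_nhds.1 hx)
  exact hneg.not_ge (mem_hemisphere_iff.1 (hC hz))

theorem mem_frontier_hemisphere_iff {x m : Sph d} :
    x ∈ frontier (hemisphere m) ↔ ⟪m.1, x.1⟫ = 0 := by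
  rw [(isClosed_hemisphere m).frontier_eq]
  refine ⟨fun ⟨hmem, hint⟩ => ?_, fun h =>
    ⟨mem_hemisphere_iff.2 h.ge, notMem_interior_of_inner_eq_zero subset_rfl h⟩⟩
  by_contra hne
  have hopen : IsOpen {y : Sph d | 0 < ⟪m.1, y.1⟫} := isOpen_lt (by fun_prop) (by fun_prop)
  exact hint (mem_interior.2 ⟨_, fun y hy => mem_hemisphere_iff.2 (le_of_lt hy), hopen,
    (mem_hemisphere_iff.1 hmem).lt_of_ne' hne⟩)

theorem supports_iff {W : Set (Sph d)} (hW : IsClosed W) {k : Sph d} :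
    Supports k W ↔ k.1 ∈ dualBoundary (Subtype.val '' W) := by
  constructor
  · rintro ⟨hsub, x, hxW, hxk⟩
    exact ⟨⟨norm_coe k, Set.forall_mem_image.2 fun y hy => mem_hemisphere_iff.1 (hsub hy)⟩,
      x, ⟨x, hW.frontier_subset hxW, rfl⟩, mem_frontier_hemisphere_iff.1 hxk⟩
  · rintro ⟨⟨-, hnonneg⟩, _, ⟨x, hx, rfl⟩, hkx⟩
    have hsub : W ⊆ hemisphere k := fun y hy => mem_hemisphere_iff.2 (hnonneg y ⟨y, hy, rfl⟩)
    refine ⟨hsub, x, ?_, mem_frontier_hemisphere_iff.2 hkx⟩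
    rw [hW.frontier_eq]
    exact ⟨hx, notMem_interior_of_inner_eq_zero hsub hkx⟩

theorem IsConvexBody.isSphericalBody {W : Set (Sph d)} (hW : IsConvexBody W) :
    IsSphericalBody (Subtype.val '' W) where
  norm_eq_one := Set.forall_mem_image.2 fun x _ => norm_coe x
  isCompact := hW.closed.isCompact.image continuous_subtype_val
  nonempty := (hW.interior_nonempty.mono interior_subset).image _
  neg_notMem := by
    rintro _ ⟨x, hx, rfl⟩ ⟨y, hy, hyx⟩
    have heq : y = -x := Subtype.ext hyx
    exact hW.convex.1 x hx (heq ▸ hy)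
  smul_add_smul_mem := by
    rintro _ ⟨a, ha, rfl⟩ _ ⟨b, hb, rfl⟩ s t hs ht hnorm
    exact ⟨⟨_, mem_sphere_zero_iff_norm.2 hnorm⟩, hW.convex.2 a ha b hb ⟨s, t, hs, ht, rfl⟩, rfl⟩
  eq_zero_of_forall_inner_eq_zero := by
    intro k hk
    by_contra hk0
    let u : Sph d := ⟨normalize k, mem_sphere_zero_iff_norm.2 (norm_normalize_eq_one_iff.2 hk0)⟩
    have hu : ∀ x ∈ W, ⟪u.1, x.1⟫ = 0 := fun x hx => by
      rw [inner_normalize_left, hk x ⟨x, hx, rfl⟩, mul_zero]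
    obtain ⟨x, hx⟩ := hW.interior_nonempty
    obtain ⟨z, hz, hneg⟩ := exists_inner_neg_of_mem_nhds (hu x (interior_subset hx))
      (mem_interior_iff_mem_nhds.1 hx)
    exact hneg.ne (hu z hz)

theorem IsConvexBody.nontrivial {W : Set (Sph d)} (hd : 1 ≤ d) (hW : IsConvexBody W) :
    (Subtype.val '' W).Nontrivial :=
  hW.isSphericalBody.nontrivial_of_one_lt_finrank (by rw [finrank_euclideanSpace_fin]; omega)

section Lune

variable {g h : Sph d}

theorem mem_luneFace_iff {x : Sph d} :
    x ∈ luneFace g h ↔ ⟪g.1, x.1⟫ = 0 ∧ 0 ≤ ⟪h.1, x.1⟫ := by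
  rw [luneFace, Set.mem_inter_iff, mem_frontier_hemisphere_iff, mem_hemisphere_iff]

theorem IsSubhemisphereWithCenter.center_unique {A : Set (Sph d)} {c c' : Sph d}
    (hc : IsSubhemisphereWithCenter A c) (hc' : IsSubhemisphereWithCenter A c') : c = c' := by
  obtain ⟨n, hn, rfl⟩ := hc
  obtain ⟨n', hn', hA⟩ := hc'
  have hself : ∀ x : Sph d, x ∈ hemisphere x := fun x =>
    mem_hemisphere_iff.2 real_inner_self_nonneg
  obtain ⟨hnc', -⟩ := hA.ge ⟨hn', hself c'⟩
  obtain ⟨-, hcc'⟩ := hA.le ⟨hn, hself c⟩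
  by_contra hne
  have hsq : ⟪c'.1, c.1⟫ ^ 2 < 1 := by
    refine inner_sq_lt_one (norm_coe c') (norm_coe c) (fun h => hne (Subtype.ext h.symm))
      fun h => ?_
    have hnonneg := mem_hemisphere_iff.1 hcc'
    rw [h, inner_neg_left, inner_self_eq_one_of_norm_eq_one (norm_coe c)] at hnonneg
    norm_num at hnonneg
  let y : Sph d := ⟨arcDirection c.1 c'.1,
    mem_sphere_zero_iff_norm.2 (norm_arcDirection (norm_coe c') (norm_coe c) hsq)⟩
  have hny : ⟪n.1, (-y).1⟫ = 0 := by
    rw [coe_neg_sphere, inner_neg_right, inner_arcDirection_of_inner_eq_zero hnc' hn, neg_zero]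
  have hcy : ⟪c.1, (-y).1⟫ = 0 := by
    rw [coe_neg_sphere, inner_neg_right, real_inner_comm,
      inner_arcDirection_source _ (norm_coe c), neg_zero]
  obtain ⟨-, hneg⟩ := hA.le ⟨hny, mem_hemisphere_iff.2 hcy.ge⟩
  have hle := mem_hemisphere_iff.1 hneg
  rw [coe_neg_sphere, inner_neg_right, real_inner_comm,
    inner_arcDirection_target _ (norm_coe c')] at hle
  linarith [Real.sqrt_pos.2 (sub_pos.2 hsq)]

namespace FormLune

theorem symm (hgh : FormLune g h) : FormLune h g :=
  ⟨hgh.1.symm, fun heq => hgh.2 (by rw [heq, neg_neg])⟩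

theorem inner_sq_lt_one (hgh : FormLune g h) : ⟪g.1, h.1⟫ ^ 2 < 1 :=
  SphericalConvex.inner_sq_lt_one (norm_coe g) (norm_coe h) (Subtype.coe_ne_coe.2 hgh.1)
    (Subtype.coe_ne_coe.2 hgh.2)

/-- The center of the face `luneFace g h` of a lune: the point at distance `π / 2` from `g` on the
great circle from `g` through `h`. -/
noncomputable def faceCenter (hgh : FormLune g h) : Sph d :=
  ⟨arcDirection g.1 h.1, mem_sphere_zero_iff_norm.2
    (norm_arcDirection (norm_coe h) (norm_coe g) hgh.symm.inner_sq_lt_one)⟩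

theorem isSubhemisphereWithCenter_faceCenter (hgh : FormLune g h) :
    IsSubhemisphereWithCenter (luneFace g h) hgh.faceCenter := by
  refine ⟨g, (real_inner_comm _ _).trans (inner_arcDirection_source _ (norm_coe g)), ?_⟩
  ext x
  refine mem_luneFace_iff.trans (and_congr_right fun hx => ?_)
  have hsin : 0 < √(1 - ⟪h.1, g.1⟫ ^ 2) :=
    Real.sqrt_pos.2 (sub_pos.2 hgh.symm.inner_sq_lt_one)
  refine Iff.trans ?_ mem_hemisphere_iff.symm
  rw [faceCenter, inner_arcDirection_left, hx, mul_zero, sub_zero,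
    mul_nonneg_iff_of_pos_left (inv_pos.2 hsin)]

theorem sdist_faceCenter (hgh : FormLune g h) :
    sdist hgh.faceCenter hgh.symm.faceCenter = Real.arccos (-⟪g.1, h.1⟫) := by
  rw [sdist_eq_arccos, real_inner_comm h.1 g.1]
  exact congrArg Real.arccos (inner_arcDirection_arcDirection (norm_coe h) (norm_coe g)
    hgh.symm.inner_sq_lt_one)

end FormLune

theorem isLuneThickness_iff {t : ℝ} :
    IsLuneThickness g h t ↔ FormLune g h ∧ t = Real.arccos (-⟪g.1, h.1⟫) := by
  refine and_congr_right fun hgh => ⟨?_, fun ht => ?_⟩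
  · rintro ⟨a, b, ha, hb, rfl⟩
    rw [ha.center_unique hgh.isSubhemisphereWithCenter_faceCenter,
      hb.center_unique hgh.symm.isSubhemisphereWithCenter_faceCenter, hgh.sdist_faceCenter]
  · exact ⟨_, _, hgh.isSubhemisphereWithCenter_faceCenter,
      hgh.symm.isSubhemisphereWithCenter_faceCenter, ht.trans hgh.sdist_faceCenter.symm⟩

end Lune

variable {W : Set (Sph d)}

theorem IsConvexBody.exists_width_eq (hd : 1 ≤ d) (hW : IsConvexBody W) {k : Sph d}
    (hk : Supports k W) : ∃ m ∈ dualBoundary (Subtype.val '' W),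
      width k W = Real.arccos (-⟪k.1, m⟫) ∧
        ∀ n ∈ dualBoundary (Subtype.val '' W), ⟪k.1, m⟫ ≤ ⟪k.1, n⟫ := by
  have hV := hW.isSphericalBody
  have hkV := (supports_iff hW.closed).1 hk
  obtain ⟨m, hm, hmin⟩ := (isCompact_dualBoundary hV.isCompact).exists_isMinOn ⟨k.1, hkV⟩
    (f := fun m => ⟪k.1, m⟫) (by fun_prop)
  let m' : Sph d := ⟨m, mem_sphere_zero_iff_norm.2 hm.1.1⟩
  have hne : k ≠ m' := by
    intro heq
    have hkm : k.1 = m := congrArg Subtype.val heq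
    obtain ⟨n, hn, hnk⟩ := (hV.dualBoundary_nontrivial (hW.nontrivial hd)).exists_ne k.1
    have hlt := (inner_lt_one_iff_real_of_norm_eq_one (norm_coe k) hn.1.1).2 hnk.symm
    have hle : ⟪k.1, m⟫ ≤ ⟪k.1, n⟫ := hmin hn
    rw [← hkm, inner_self_eq_one_of_norm_eq_one (norm_coe k)] at hle
    exact hlt.not_ge hle
  have hne' : k ≠ -m' := fun heq => by
    have hkm : k.1 = -m := congrArg Subtype.val heq
    exact hV.neg_notMem_dualBody hm.1 (hkm ▸ hkV.1)
  refine ⟨m, hm, IsLeast.csInf_eq ⟨?_, ?_⟩, hmin⟩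
  · exact ⟨m', (supports_iff hW.closed).2 hm, isLuneThickness_iff.2 ⟨⟨hne, hne'⟩, rfl⟩⟩
  · rintro t ⟨n, hn, ht⟩
    rw [(isLuneThickness_iff.1 ht).2]
    exact Real.arccos_le_arccos (neg_le_neg (hmin ((supports_iff hW.closed).1 hn)))

namespace IsBodyOfConstantWidth

variable {w : ℝ}

theorem exists_eq_arccos (hd : 1 ≤ d) (hW : IsBodyOfConstantWidth W w)
    {k : EuclideanSpace ℝ (Fin (d + 1))} (hk : k ∈ dualBoundary (Subtype.val '' W)) :
    ∃ m ∈ dualBoundary (Subtype.val '' W), w = Real.arccos (-⟪k, m⟫) ∧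
      ∀ n ∈ dualBoundary (Subtype.val '' W), ⟪k, m⟫ ≤ ⟪k, n⟫ := by
  let k' : Sph d := ⟨k, mem_sphere_zero_iff_norm.2 hk.1.1⟩
  have hk' : Supports k' W := (supports_iff hW.1.closed).2 hk
  rw [← hW.2 k' hk']
  exact hW.1.exists_width_eq hd hk'

theorem mem_Icc (hd : 1 ≤ d) (hW : IsBodyOfConstantWidth W w) : w ∈ Set.Icc 0 Real.pi := by
  obtain ⟨k, hk⟩ :=
    (hW.1.isSphericalBody.dualBoundary_nontrivial (hW.1.nontrivial hd)).nonempty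
  obtain ⟨m, -, rfl, -⟩ := hW.exists_eq_arccos hd hk
  exact ⟨Real.arccos_nonneg _, Real.arccos_le_pi _⟩

theorem hasConstantDiameter_dualBoundary (hd : 1 ≤ d) (hW : IsBodyOfConstantWidth W w) :
    HasConstantDiameter (dualBoundary (Subtype.val '' W)) (-Real.cos w) := by
  have hfarthest : ∀ k ∈ dualBoundary (Subtype.val '' W), ∃ m ∈ dualBoundary (Subtype.val '' W),
      ⟪k, m⟫ = -Real.cos w ∧ ∀ n ∈ dualBoundary (Subtype.val '' W), ⟪k, m⟫ ≤ ⟪k, n⟫ := by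
    intro k hk
    obtain ⟨m, hm, rfl, hmin⟩ := hW.exists_eq_arccos hd hk
    have habs := abs_le.1 (abs_real_inner_le_norm k m)
    rw [hk.1.1, hm.1.1, one_mul] at habs
    refine ⟨m, hm, ?_, hmin⟩
    rw [Real.cos_arccos (neg_le_neg habs.2) (neg_le.1 habs.1), neg_neg]
  constructor
  · intro k hk n hn
    obtain ⟨m, -, hkm, hmin⟩ := hfarthest k hk
    exact hkm.ge.trans (hmin n hn)
  · intro k hk
    obtain ⟨m, hm, hkm, -⟩ := hfarthest k hk
    exact ⟨m, hm, hkm⟩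

end IsBodyOfConstantWidth

end Sphere

end SphericalConvex

theorem mainTheorem9_general (d : ℕ) (hd : 1 ≤ d) (W : Set (SphericalConvex.Sph d)) (w : ℝ)
    (hW : SphericalConvex.IsBodyOfConstantWidth W w) :
    SphericalConvex.sdiam W = w := by
  obtain ⟨⟨_, ⟨a, ha, rfl⟩, _, ⟨b, hb, rfl⟩, hab⟩, hmin⟩ := hW.1.isSphericalBody.isLeast_inner
    (hW.1.nontrivial hd) (hW.hasConstantDiameter_dualBoundary hd)
  rw [neg_neg] at hab hmin
  obtain ⟨hw0, hwπ⟩ := hW.mem_Icc hd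
  refine IsGreatest.csSup_eq ⟨⟨a, ha, b, hb, ?_⟩, ?_⟩
  · exact (Real.arccos_cos hw0 hwπ).symm.trans
      ((congrArg Real.arccos hab.symm).trans (SphericalConvex.sdist_eq_arccos a b).symm)
  · rintro _ ⟨x, hx, y, hy, rfl⟩
    have hle : Real.cos w ≤ ⟪x.1, y.1⟫ := hmin (Set.mem_image2_of_mem ⟨x, hx, rfl⟩ ⟨y, hy, rfl⟩)
    rw [SphericalConvex.sdist_eq_arccos, ← Real.arccos_cos hw0 hwπ]
    exact Real.arccos_le_arccos hle

theorem mainTheorem9 (d : ℕ) (hd : 2 ≤ d) (W : Set (SphericalConvex.Sph d)) (w : ℝ)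
    (hW : SphericalConvex.IsBodyOfConstantWidth W w) :
    SphericalConvex.sdiam W = w :=
  mainTheorem9_general d (one_le_two.trans hd) W w hW
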